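/- Let $\mathbb F$ be an algebraically closed field and let $q\in\mathbb F$ be nonzero and not a root of unity. The universal Askey--Wilson algebra $\triangle_q$ is the unital associative $\mathbb F$-algebra generated by $A,B,C$ subject to the relations that each of $$A+\frac{qBC-q^{-1}CB}{q^2-q^{-2}},\qquad B+\frac{qCA-q^{-1}AC}{q^2-q^{-2}},\qquad C+\frac{qAB-q^{-1}BA}{q^2-q^{-2}}$$ commutes with $A,B,C$. The universal DAHA $\mathfrak H_q$ of type $(C_1^\vee,C_1)$ is the unital associative $\mathbb F$-algebra generated by $t_i^{\pm1}$ ($i=0,1,2,3$) subject to the relations $t_it_i^{-1}=t_i^{-1}t_i=1$, $t_i+t_i^{-1}$ is central ($i=0,1,2,3$), and $t_0t_1t_2t_3=q^{-1}$. Every $\mathfrak H_q$-module is regarded as a $\triangle_q$-module via the algebra homomorphism $\zeta:\triangle_q\to\mathfrak H_q$ with $$A\mapsto t_1t_0+(t_1t_0)^{-1},\qquad B\mapsto t_3t_0+(t_3t_0)^{-1},\qquad C\mapsto t_2t_0+(t_2t_0)^{-1}.$$ Let $d\ge 1$ be an odd integer and let $k_0,k_1,k_2,k_3\in\mathbb F$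 be nonzero with $k_0^2=q^{-d-1}$. Let $E=E(k_0,k_1,k_2,k_3)$ be the $(d+1)$-dimensional $\mathfrak H_q$-module with $\mathbb F$-basis $v_0,\dots,v_d$ on which $t_i+t_i^{-1}$ acts as the scalar $k_i+k_i^{-1}$ ($i=0,1,2,3$) and \begin{align*} t_0v_i&=k_0^{-1}q^{-i}(1-q^i)(1-k_0^2q^i)v_{i-1}+(k_0+k_0^{-1}-k_0^{-1}q^{-i})v_i && (i=2,4,\dots,d-1),\\ t_0v_i&=k_0^{-1}q^{-i-1}(v_i-v_{i+1}) && (i=1,3,\dots,d-2),\\ t_0v_0&=k_0v_0,\qquad t_0v_d=k_0v_d,\\ t_1v_i&=-k_1(1-q^i)(1-k_0^2q^i)v_{i-1}+k_1v_i+k_1^{-1}v_{i+1} && (i=2,4,\dots,d-1),\\ t_1v_i&=k_1^{-1}v_i && (i=1,3,\dots,d),\\ t_1v_0&=k_1v_0+k_1^{-1}v_1,\\ t_2v_i&=k_0^{-1}k_1^{-1}k_3^{-1}q^{-i-1}(v_i-v_{i+1}) && (i=0,2,\dots,d-1),\\ t_2v_i&=\frac{(k_0k_1k_3q^i-k_2)(k_0k_1k_3q^i-k_2^{-1})}{k_0k_1k_3q^i}v_{i-1}+(k_2+k_2^{-1}-k_0^{-1}k_1^{-1}k_3^{-1}q^{-i})v_i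 && (i=1,3,\dots,d),\\ t_3v_i&=k_3v_i && (i=0,2,\dots,d-1),\\ t_3v_i&=-k_3^{-1}(k_0k_1k_3q^i-k_2)(k_0k_1k_3q^i-k_2^{-1})v_{i-1}+k_3^{-1}v_i+k_3v_{i+1} && (i=1,3,\dots,d-2),\\ t_3v_d&=-k_3^{-1}(k_0k_1k_3q^d-k_2)(k_0k_1k_3q^d-k_2^{-1})v_{d-1}+k_3^{-1}v_d. \end{align*} For $\theta\in\mathbb F$ put $E(\theta)=\{v\in E\mid t_0v=\theta v\}$, which is a $\triangle_q$-submodule of $E$. Assume that the $\mathfrak H_q$-module $E$ is irreducible. Then: (i) If $d=1$, the $\triangle_q$-module $E$ is irreducible. (ii) If $d\ge 3$, the lattice of $\triangle_q$-submodules of $E$ is the diamond: its elements are exactly the four distinct submodules $\{0\}$, $E(k_0)$, $E(k_0^{-1})$, $E$, where $E(k_0)$ and $E(k_0^{-1})$ are incomparable and lie strictly between $\{0\}$ and $E$. -/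

import Mathlib

/-!
The universal Askey–Wilson algebra, the universal DAHA of type `(C₁^∨, C₁)`, the homomorphism
between them, the even-dimensional modules `E(k₀,k₁,k₂,k₃)` and the eigenspaces of `t₀`.
-/

namespace DahaAW

/-! ### Presentations of the two algebras -/

/-- The formal generators `A, B, C`. -/
inductive AWGen : Type
  | A | B | C

/-- The elements `A + (q BC - q⁻¹ CB)/(q² - q⁻²)` and its two cyclic companions, for three
elements of an `F`-algebra: apply to `(A,B,C)`, `(B,C,A)`, `(C,A,B)`. -/
def awElt {F R : Type*} [Field F] [Ring R] [Algebra F R] (q : F) (a b c : R) : R :=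
  a + (q ^ 2 - q⁻¹ ^ 2)⁻¹ • (q • (b * c) - q⁻¹ • (c * b))

/-- The defining relations of `△_q`. -/
inductive AWRel {F : Type*} [Field F] (q : F) :
    FreeAlgebra F AWGen → FreeAlgebra F AWGen → Prop
  | commA (g : AWGen) : AWRel q
      (awElt q (FreeAlgebra.ι F .A) (FreeAlgebra.ι F .B) (FreeAlgebra.ι F .C) *
        FreeAlgebra.ι F g)
      (FreeAlgebra.ι F g *
        awElt q (FreeAlgebra.ι F .A) (FreeAlgebra.ι F .B) (FreeAlgebra.ι F .C))
  | commB (g : AWGen) : AWRel q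
      (awElt q (FreeAlgebra.ι F .B) (FreeAlgebra.ι F .C) (FreeAlgebra.ι F .A) *
        FreeAlgebra.ι F g)
      (FreeAlgebra.ι F g *
        awElt q (FreeAlgebra.ι F .B) (FreeAlgebra.ι F .C) (FreeAlgebra.ι F .A))
  | commC (g : AWGen) : AWRel q
      (awElt q (FreeAlgebra.ι F .C) (FreeAlgebra.ι F .A) (FreeAlgebra.ι F .B) *
        FreeAlgebra.ι F g)
      (FreeAlgebra.ι F g *
        awElt q (FreeAlgebra.ι F .C) (FreeAlgebra.ι F .A) (FreeAlgebra.ι F .B))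

/-- The universal Askey–Wilson algebra `△_q`. -/
abbrev AW {F : Type*} [Field F] (q : F) : Type _ := RingQuot (AWRel q)

/-- The formal generators `tᵢ` and `tᵢ⁻¹`, `i = 0,1,2,3`. -/
inductive DAHAGen : Type
  | t (i : Fin 4)
  | tinv (i : Fin 4)

/-- The defining relations of `ℌ_q`. -/
inductive DAHARel {F : Type*} [Field F] (q : F) :
    FreeAlgebra F DAHAGen → FreeAlgebra F DAHAGen → Prop
  | mul_inv (i : Fin 4) : DAHARel q
      (FreeAlgebra.ι F (.t i) * FreeAlgebra.ι F (.tinv i)) 1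
  | inv_mul (i : Fin 4) : DAHARel q
      (FreeAlgebra.ι F (.tinv i) * FreeAlgebra.ι F (.t i)) 1
  | central (i : Fin 4) (x : FreeAlgebra F DAHAGen) : DAHARel q
      ((FreeAlgebra.ι F (.t i) + FreeAlgebra.ι F (.tinv i)) * x)
      (x * (FreeAlgebra.ι F (.t i) + FreeAlgebra.ι F (.tinv i)))
  | prod : DAHARel q
      (FreeAlgebra.ι F (.t 0) * FreeAlgebra.ι F (.t 1) * FreeAlgebra.ι F (.t 2) *
        FreeAlgebra.ι F (.t 3))
      (algebraMap F _ q⁻¹)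

/-- The universal double affine Hecke algebra `ℌ_q` of type `(C₁^∨, C₁)`. -/
abbrev DAHA {F : Type*} [Field F] (q : F) : Type _ := RingQuot (DAHARel q)

section Algebras

variable {F : Type*} [Field F] (q : F)

/-- The element `tᵢ` of `ℌ_q`. -/
noncomputable def t (i : Fin 4) : DAHA q :=
  RingQuot.mkAlgHom F (DAHARel q) (FreeAlgebra.ι F (.t i))

/-- The element `tᵢ⁻¹` of `ℌ_q`. -/
noncomputable def tinv (i : Fin 4) : DAHA q :=
  RingQuot.mkAlgHom F (DAHARel q) (FreeAlgebra.ι F (.tinv i))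

/-- The image of a generator of `△_q`: `A ↦ t₁t₀ + (t₁t₀)⁻¹`, `B ↦ t₃t₀ + (t₃t₀)⁻¹`,
`C ↦ t₂t₀ + (t₂t₀)⁻¹`. -/
noncomputable def zetaGen : AWGen → DAHA q
  | .A => t q 1 * t q 0 + tinv q 0 * tinv q 1
  | .B => t q 3 * t q 0 + tinv q 0 * tinv q 3
  | .C => t q 2 * t q 0 + tinv q 0 * tinv q 2

theorem t_mul_tinv (i : Fin 4) : t q i * tinv q i = 1 := by
  simpa [t, tinv] using RingQuot.mkAlgHom_rel F (DAHARel.mul_inv (q := q) i)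

theorem tinv_mul_t (i : Fin 4) : tinv q i * t q i = 1 := by
  simpa [t, tinv] using RingQuot.mkAlgHom_rel F (DAHARel.inv_mul (q := q) i)

theorem t_add_tinv_comm (i : Fin 4) (x : DAHA q) :
    (t q i + tinv q i) * x = x * (t q i + tinv q i) := by
  obtain ⟨y, rfl⟩ := RingQuot.mkAlgHom_surjective F (DAHARel q) x
  simpa [t, tinv] using RingQuot.mkAlgHom_rel F (DAHARel.central (q := q) i y)

theorem t_prod : t q 0 * t q 1 * t q 2 * t q 3 = algebraMap F _ q⁻¹ := by
  simpa only [t, map_mul, AlgHom.commutes] using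
    RingQuot.mkAlgHom_rel F (DAHARel.prod (q := q))

end Algebras

/-! ### Facts needed for the homomorphism `△_q → ℌ_q` -/

section Zeta

variable {F R : Type*} [Field F] [Ring R] [Algebra F R]

theorem t0_commutes {t0 s0 t1 s1 : R} (h0 : t0 * s0 = 1) (h0' : s0 * t0 = 1)
    (z0 : ∀ x, (t0 + s0) * x = x * (t0 + s0)) (z1 : ∀ x, (t1 + s1) * x = x * (t1 + s1)) :
    t0 * (t1 * t0 + s0 * s1) = (t1 * t0 + s0 * s1) * t0 := by
  have e1 : t0 * (s0 * s1) = s1 := by rw [← mul_assoc, h0, one_mul]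
  have e2 := z1 t0
  have e3 := z0 t1
  have e4 := z0 (t1 * t0)
  have e5 : t1 * t0 * s0 = t1 := by rw [mul_assoc, h0, mul_one]
  have e6 : s0 * (t1 + s1) * t0 = t1 + s1 := by
    rw [mul_assoc, z1, ← mul_assoc, h0', one_mul]
  have e7 : t1 * t0 * (t0 + s0) = t1 * t0 * t0 + t1 := by rw [mul_add, e5]
  rw [e7] at e4
  simp only [mul_add, add_mul, ← mul_assoc] at *
  rw [e1]
  have e8 : s0 * s1 * t0 = t1 + s1 - s0 * t1 * t0 := by rw [← e6]; abel
  have e9 : t0 * t1 * t0 = t1 * t0 * t0 + t1 - s0 * t1 * t0 := by rw [← e4]; abel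
  rw [e8, e9]; abel

/-- The two descriptions `t₁t₀ + (t₁t₀)⁻¹ = t₀t₁ + (t₀t₁)⁻¹`. -/
theorem bracket_symm {t0 s0 t1 s1 : R} (h0 : t0 * s0 = 1) (h0' : s0 * t0 = 1)
    (z0 : ∀ x, (t0 + s0) * x = x * (t0 + s0)) (z1 : ∀ x, (t1 + s1) * x = x * (t1 + s1)) :
    t1 * t0 + s0 * s1 = t0 * t1 + s1 * s0 := by
  have e := t0_commutes h0 h0' z0 z1
  have e2 : t0 * (t1 * t0 + s0 * s1) * s0 = t1 * t0 + s0 * s1 := by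
    rw [e, mul_assoc, h0, mul_one]
  rw [← e2, mul_add, add_mul]
  congr 1
  · rw [mul_assoc, mul_assoc, h0, mul_one]
  · rw [← mul_assoc t0, h0, one_mul]

theorem aw_identity {q : F} (hq : q ≠ 0) {t0 t1 t2 t3 s0 s1 s2 s3 : R}
    (h0 : t0 * s0 = 1) (h0' : s0 * t0 = 1) (h1 : t1 * s1 = 1) (h1' : s1 * t1 = 1)
    (h2 : t2 * s2 = 1) (h3 : t3 * s3 = 1)
    (z0 : ∀ x, (t0 + s0) * x = x * (t0 + s0)) (z1 : ∀ x, (t1 + s1) * x = x * (t1 + s1))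
    (z2 : ∀ x, (t2 + s2) * x = x * (t2 + s2)) (z3 : ∀ x, (t3 + s3) * x = x * (t3 + s3))
    (hp : t0 * t1 * t2 * t3 = algebraMap F R q⁻¹) :
    q • ((t1 * t0 + s0 * s1) * (t3 * t0 + s0 * s3)) -
        q⁻¹ • ((t3 * t0 + s0 * s3) * (t1 * t0 + s0 * s1)) +
        (q ^ 2 - q⁻¹ ^ 2) • (t2 * t0 + s0 * s2) =
      (q - q⁻¹) • ((t1 + s1) * (t3 + s3) + (t2 + s2) * (q • s0 + q⁻¹ • t0)) := by
  have hC := bracket_symm h0 h0' z0 z2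
  rw [bracket_symm h0 h0' z0 z1]
  -- three-letter words
  have hp' : t0 * t1 * t2 * t3 = q⁻¹ • (1 : R) := by rw [hp, Algebra.algebraMap_eq_smul_one]
  have w012 : t0 * t1 * t2 = q⁻¹ • s3 := by
    calc t0 * t1 * t2 = t0 * t1 * t2 * (t3 * s3) := by rw [h3, mul_one]
      _ = (t0 * t1 * t2 * t3) * s3 := by noncomm_ring
      _ = _ := by rw [hp', smul_mul_assoc, one_mul]
  have w30 : t3 * (t0 * t1 * t2) = q⁻¹ • (1 : R) := by rw [w012, mul_smul_comm, h3]
  have w301 : t3 * t0 * t1 = q⁻¹ • s2 := by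
    calc t3 * t0 * t1 = t3 * (t0 * t1 * t2) * s2 := by
          rw [show t3 * (t0 * t1 * t2) * s2 = t3 * t0 * t1 * (t2 * s2) by noncomm_ring,
            h2, mul_one]
      _ = _ := by rw [w30, smul_mul_assoc, one_mul]
  have w30b : t3 * t0 = q⁻¹ • (s2 * s1) := by
    calc t3 * t0 = t3 * t0 * t1 * s1 := by rw [mul_assoc _ t1, h1, mul_one]
      _ = _ := by rw [w301, smul_mul_assoc]
  have v12 : t1 * t2 = q⁻¹ • (s0 * s3) := by
    calc t1 * t2 = s0 * (t0 * t1 * t2) := by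
          rw [show s0 * (t0 * t1 * t2) = (s0 * t0) * (t1 * t2) by noncomm_ring, h0', one_mul]
      _ = _ := by rw [w012, mul_smul_comm]
  have v12' : s0 * s3 = q • (t1 * t2) := by rw [v12, smul_smul, mul_inv_cancel₀ hq, one_smul]
  have v103 : s1 * s0 * s3 = q • t2 := by
    rw [mul_assoc, v12', mul_smul_comm, ← mul_assoc, h1', one_mul]
  have v210 : t1 * s2 * s1 * s0 = q • (t1 * t3) := by
    have : s2 * s1 = q • (t3 * t0) := by rw [w30b, smul_smul, mul_inv_cancel₀ hq, one_smul]
    rw [mul_assoc t1, this, mul_smul_comm, smul_mul_assoc, mul_assoc t1, mul_assoc t3, h0, mul_one]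
  -- reduce the squares
  have sq0 : t0 * t0 = (t0 + s0) * t0 - 1 := by rw [add_mul, h0']; abel
  have sq0' : s0 * s0 = (t0 + s0) * s0 - 1 := by rw [add_mul, h0]; abel
  -- `AB`
  have a1 : t0 * t1 * (t3 * t0) = q⁻¹ • ((t2 + s2) * t0) - (q⁻¹ * q⁻¹) • (s3 * s1) := by
    rw [w30b, mul_smul_comm, show s2 = (t2 + s2) - t2 by abel, sub_mul, z2,
      show t0 * t1 * (s1 * (t2 + s2) - t2 * s1) =
        t0 * (t1 * s1) * (t2 + s2) - t0 * t1 * t2 * s1 by noncomm_ring, h1, mul_one, w012,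
      smul_mul_assoc, smul_sub, smul_smul, ← z2]
    congr 4; abel
  have a2 : t0 * t1 * (s0 * s3) = (t1 + s1) * s3 - q • (t0 * t2) := by
    rw [show t0 * t1 * (s0 * s3) = t0 * ((t1 + s1) * (s0 * s3)) - t0 * (s1 * s0 * s3) by
      noncomm_ring, v103, mul_smul_comm, ← mul_assoc t0, ← z1,
      show (t1 + s1) * t0 * (s0 * s3) = (t1 + s1) * (t0 * s0) * s3 by noncomm_ring, h0, mul_one]
  have a3 : s1 * s0 * (t3 * t0) = (t3 + s3) * s1 - q • (t2 * t0) := by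
    rw [show s1 * s0 * (t3 * t0) = s1 * s0 * (t3 + s3) * t0 - s1 * s0 * s3 * t0 by
      noncomm_ring, v103, smul_mul_assoc, ← z3,
      show (t3 + s3) * (s1 * s0) * t0 = (t3 + s3) * s1 * (s0 * t0) by noncomm_ring, h0', mul_one]
  have a4 : s1 * s0 * (s0 * s3) = q • ((t0 + s0) * t2) - s1 * s3 := by
    rw [show s1 * s0 * (s0 * s3) = s1 * (s0 * s0) * s3 by noncomm_ring, sq0',
      show s1 * ((t0 + s0) * s0 - 1) * s3 = s1 * (t0 + s0) * s0 * s3 - s1 * s3 by noncomm_ring,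
      ← z0, show (t0 + s0) * s1 * s0 * s3 = (t0 + s0) * (s1 * s0 * s3) by noncomm_ring, v103,
      mul_smul_comm]
  -- `BA`
  have b1 : t3 * t0 * (t0 * t1) = q⁻¹ • ((t0 + s0) * s2) - t3 * t1 := by
    rw [show t3 * t0 * (t0 * t1) = t3 * (t0 * t0) * t1 by noncomm_ring, sq0,
      show t3 * ((t0 + s0) * t0 - 1) * t1 = t3 * (t0 + s0) * t0 * t1 - t3 * t1 by noncomm_ring,
      ← z0, show (t0 + s0) * t3 * t0 * t1 = (t0 + s0) * (t3 * t0 * t1) by noncomm_ring, w301,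
      mul_smul_comm]
  have b2 : t3 * t0 * (s1 * s0) = (t1 + s1) * t3 - q⁻¹ • (s2 * s0) := by
    rw [show t3 * t0 * (s1 * s0) = t3 * t0 * (t1 + s1) * s0 - t3 * t0 * t1 * s0 by
      noncomm_ring, w301, smul_mul_assoc, ← z1,
      show (t1 + s1) * (t3 * t0) * s0 = (t1 + s1) * t3 * (t0 * s0) by noncomm_ring, h0, mul_one]
  have b3 : s0 * s3 * (t0 * t1) = (t3 + s3) * t1 - q⁻¹ • (s0 * s2) := by
    rw [show s0 * s3 * (t0 * t1) = s0 * (t3 + s3) * t0 * t1 - s0 * (t3 * t0 * t1) by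
      noncomm_ring, w301, mul_smul_comm, ← z3,
      show (t3 + s3) * s0 * t0 * t1 = (t3 + s3) * (s0 * t0) * t1 by noncomm_ring, h0', mul_one]
  have b4 : s0 * s3 * (s1 * s0) = q • ((t2 + s2) * s0) - (q * q) • (t1 * t3) := by
    rw [v12', smul_mul_assoc,
      show t1 * t2 * (s1 * s0) = t1 * (t2 + s2) * (s1 * s0) - t1 * s2 * s1 * s0 by noncomm_ring,
      v210, ← z2,
      show (t2 + s2) * t1 * (s1 * s0) = (t2 + s2) * (t1 * s1) * s0 by noncomm_ring, h1, mul_one,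
      smul_sub, smul_smul]
  have f4 := z2 t0
  have f5 := z2 s0
  have f7 := z1 s3
  have f9 := z3 s1
  have hq2 : (q ^ 2 - q⁻¹ ^ 2) • (t2 * t0 + s0 * s2) =
      q ^ 2 • (t2 * t0 + s0 * s2) - q⁻¹ ^ 2 • (t0 * t2 + s2 * s0) := by
    rw [sub_smul, hC]
  rw [show (t0 * t1 + s1 * s0) * (t3 * t0 + s0 * s3) = t0 * t1 * (t3 * t0) +
      t0 * t1 * (s0 * s3) + s1 * s0 * (t3 * t0) + s1 * s0 * (s0 * s3) by noncomm_ring,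
    show (t3 * t0 + s0 * s3) * (t0 * t1 + s1 * s0) = t3 * t0 * (t0 * t1) +
      t3 * t0 * (s1 * s0) + s0 * s3 * (t0 * t1) + s0 * s3 * (s1 * s0) by noncomm_ring,
    a1, a2, a3, a4, b1, b2, b3, b4, hq2]
  simp only [add_mul, mul_add, mul_smul_comm] at f4 f5 f7 f9 ⊢
  linear_combination (norm := skip) (-(q ^ 2)) • f5 + (q⁻¹ ^ 2) • f4 + q⁻¹ • f7 + q • f9
  match_scalars <;> field_simp <;> ring

/-- The third distinguished element commutes with everything that commutes with `t₀`. -/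
theorem awElt_comm {q : F} (hq : q ≠ 0) (hq4 : q ^ 2 - q⁻¹ ^ 2 ≠ 0)
    {t0 t1 t2 t3 s0 s1 s2 s3 : R}
    (h0 : t0 * s0 = 1) (h0' : s0 * t0 = 1) (h1 : t1 * s1 = 1) (h1' : s1 * t1 = 1)
    (h2 : t2 * s2 = 1) (h3 : t3 * s3 = 1)
    (z0 : ∀ x, (t0 + s0) * x = x * (t0 + s0)) (z1 : ∀ x, (t1 + s1) * x = x * (t1 + s1))
    (z2 : ∀ x, (t2 + s2) * x = x * (t2 + s2)) (z3 : ∀ x, (t3 + s3) * x = x * (t3 + s3))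
    (hp : t0 * t1 * t2 * t3 = algebraMap F R q⁻¹) (x : R) (hx : t0 * x = x * t0) :
    awElt q (t2 * t0 + s0 * s2) (t1 * t0 + s0 * s1) (t3 * t0 + s0 * s3) * x =
      x * awElt q (t2 * t0 + s0 * s2) (t1 * t0 + s0 * s1) (t3 * t0 + s0 * s3) := by
  have key := aw_identity hq h0 h0' h1 h1' h2 h3 z0 z1 z2 z3 hp
  have e : awElt q (t2 * t0 + s0 * s2) (t1 * t0 + s0 * s1) (t3 * t0 + s0 * s3) =
      (q ^ 2 - q⁻¹ ^ 2)⁻¹ •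
        ((q - q⁻¹) • ((t1 + s1) * (t3 + s3) + (t2 + s2) * (q • s0 + q⁻¹ • t0))) := by
    rw [← key, smul_add, smul_smul, inv_mul_cancel₀ hq4, one_smul, awElt, add_comm]
  have hs : s0 * x = x * s0 := by
    calc s0 * x = s0 * x * (t0 * s0) := by rw [h0, mul_one]
      _ = s0 * (x * t0) * s0 := by noncomm_ring
      _ = (s0 * t0) * x * s0 := by rw [← hx]; noncomm_ring
      _ = x * s0 := by rw [h0', one_mul]
  have C1 : Commute (t1 + s1) x := z1 x
  have C2 : Commute (t2 + s2) x := z2 x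
  have C3 : Commute (t3 + s3) x := z3 x
  have D0 : Commute t0 x := hx
  have D1 : Commute s0 x := hs
  rw [e]
  exact ((((C1.mul_left C3).add_left (C2.mul_left
    ((D1.smul_left q).add_left (D0.smul_left q⁻¹)))).smul_left _).smul_left _)

/-- `q` is nonzero and not a root of unity. -/
structure Generic (q : F) : Prop where
  ne_zero : q ≠ 0
  pow_ne_one : ∀ n : ℕ, 0 < n → q ^ n ≠ 1

theorem Generic.denom_ne_zero {q : F} (hq : Generic q) : q ^ 2 - q⁻¹ ^ 2 ≠ 0 := by
  intro h
  apply hq.pow_ne_one 4 (by norm_num)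
  have h0 := hq.ne_zero
  field_simp at h
  linear_combination h

variable {q : F}

theorem t0_comm_zetaGen (g : AWGen) : t q 0 * zetaGen q g = zetaGen q g * t q 0 := by
  cases g <;> exact t0_commutes (t_mul_tinv q 0) (tinv_mul_t q 0) (t_add_tinv_comm q 0)
    (t_add_tinv_comm q _)

theorem zetaGen_rel (hq : Generic q) ⦃x y : FreeAlgebra F AWGen⦄ (h : AWRel q x y) :
    FreeAlgebra.lift F (zetaGen q) x = FreeAlgebra.lift F (zetaGen q) y := by
  have e (i : Fin 4) := t_mul_tinv q i
  have e' (i : Fin 4) := tinv_mul_t q i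
  have z (i : Fin 4) := t_add_tinv_comm q i
  have P : (t q 0 * t q 1 * t q 2 * t q 3) = q⁻¹ • (1 : DAHA q) := by
    rw [t_prod, Algebra.algebraMap_eq_smul_one]
  -- conjugation by `t₀`
  have cz (i : Fin 4) :
      t q 0 * t q i * tinv q 0 + t q 0 * tinv q i * tinv q 0 = t q i + tinv q i := by
    rw [← add_mul, ← mul_add, ← z, mul_assoc, e, mul_one]
  have cz' (i : Fin 4) :
      tinv q 0 * t q i * t q 0 + tinv q 0 * tinv q i * t q 0 = t q i + tinv q i := by
    rw [← add_mul, ← mul_add, ← z, mul_assoc, e', mul_one]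
  cases h with
  | commA g =>
    simp only [map_mul, FreeAlgebra.lift_ι_apply, awElt, map_add, map_sub, map_smul]
    have hB : tinv q 0 * t q 3 * t q 0 * t q 0 + tinv q 0 * (tinv q 0 * tinv q 3 * t q 0) =
        zetaGen q .B := by
      have := t0_comm_zetaGen (q := q) .B
      calc _ = tinv q 0 * (zetaGen q .B * t q 0) := by rw [zetaGen]; noncomm_ring
        _ = _ := by rw [← this, ← mul_assoc, e', one_mul]
    rw [← hB]
    refine awElt_comm hq.ne_zero hq.denom_ne_zero (e 0) (e' 0) ?_ ?_ (e 1) (e 2)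
      (z 0) (fun x => by rw [cz', z]) (z 1) (z 2) ?_ _ (t0_comm_zetaGen g)
    · calc _ = tinv q 0 * t q 3 * (t q 0 * tinv q 0) * tinv q 3 * t q 0 := by noncomm_ring
        _ = tinv q 0 * (t q 3 * tinv q 3) * t q 0 := by rw [e, mul_one]; noncomm_ring
        _ = 1 := by rw [e, mul_one, e']
    · calc _ = tinv q 0 * tinv q 3 * (t q 0 * tinv q 0) * t q 3 * t q 0 := by noncomm_ring
        _ = tinv q 0 * (tinv q 3 * t q 3) * t q 0 := by rw [e, mul_one]; noncomm_ring
        _ = 1 := by rw [e', mul_one, e']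
    · calc _ = (t q 0 * tinv q 0) * t q 3 * t q 0 * t q 1 * t q 2 * (t q 3 * tinv q 3) := by
            rw [e 3]; noncomm_ring
        _ = t q 3 * (t q 0 * t q 1 * t q 2 * t q 3) * tinv q 3 := by
            rw [e 0]; noncomm_ring
        _ = _ := by
            rw [P, mul_smul_comm, smul_mul_assoc, mul_one, e, Algebra.algebraMap_eq_smul_one]
  | commB g =>
    simp only [map_mul, FreeAlgebra.lift_ι_apply, awElt, map_add, map_sub, map_smul]
    have hA : t q 0 * t q 1 * tinv q 0 * t q 0 + tinv q 0 * (t q 0 * tinv q 1 * tinv q 0) =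
        zetaGen q .A := by
      rw [zetaGen, bracket_symm (e 0) (e' 0) (z 0) (z 1), mul_assoc _ (tinv q 0), e', mul_one,
        mul_assoc (t q 0), ← mul_assoc (tinv q 0), e', one_mul]
    rw [← hA]
    refine awElt_comm hq.ne_zero hq.denom_ne_zero (e 0) (e' 0) (e 2) (e' 2) (e 3) ?_
      (z 0) (z 2) (z 3) (fun x => by rw [cz, z]) ?_ _ (t0_comm_zetaGen g)
    · calc _ = t q 0 * t q 1 * (tinv q 0 * t q 0) * tinv q 1 * tinv q 0 := by noncomm_ring
        _ = t q 0 * (t q 1 * tinv q 1) * tinv q 0 := by rw [e', mul_one]; noncomm_ring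
        _ = 1 := by rw [e, mul_one, e]
    · calc _ = t q 0 * (tinv q 1 * (tinv q 0 * t q 0) * t q 1) * t q 2 * t q 3 * t q 0 *
              t q 1 * tinv q 0 := by rw [e', mul_one, e']; noncomm_ring
        _ = t q 0 * tinv q 1 * tinv q 0 * (t q 0 * t q 1 * t q 2 * t q 3) * t q 0 *
              t q 1 * tinv q 0 := by noncomm_ring
        _ = q⁻¹ • (t q 0 * (tinv q 1 * (tinv q 0 * t q 0) * t q 1) * tinv q 0) := by
            rw [P, mul_smul_comm, smul_mul_assoc, smul_mul_assoc, smul_mul_assoc]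
            congr 1; noncomm_ring
        _ = _ := by rw [e', mul_one, e', mul_one, e, Algebra.algebraMap_eq_smul_one]
  | commC g =>
    simp only [map_mul, FreeAlgebra.lift_ι_apply, awElt, map_add, map_sub, map_smul]
    exact awElt_comm hq.ne_zero hq.denom_ne_zero (e 0) (e' 0) (e 1) (e' 1) (e 2) (e 3)
      (z 0) (z 1) (z 2) (z 3) (t_prod q) _ (t0_comm_zetaGen g)

/-- The homomorphism `ζ : △_q → ℌ_q`. -/
noncomputable def zeta (hq : Generic q) : AW q →ₐ[F] DAHA q :=
  RingQuot.liftAlgHom F ⟨FreeAlgebra.lift F (zetaGen q), zetaGen_rel hq⟩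

theorem zeta_comm_t0 (hq : Generic q) (a : AW q) : t q 0 * zeta hq a = zeta hq a * t q 0 := by
  obtain ⟨x, rfl⟩ := RingQuot.mkAlgHom_surjective F (AWRel q) a
  rw [zeta, RingQuot.liftAlgHom_mkAlgHom_apply]
  induction x using FreeAlgebra.induction with
  | grade0 r => simpa using (Algebra.commutes r (t q 0)).symm
  | grade1 g => simpa using t0_comm_zetaGen g
  | mul a b ha hb => rw [map_mul, ← mul_assoc, ha, mul_assoc, hb, mul_assoc]
  | add a b ha hb => rw [map_add, mul_add, add_mul, ha, hb]

end Zeta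

/-! ### The module `E(k₀,k₁,k₂,k₃)` -/

section Even

variable {F : Type*} [Field F]

/-- Admissible parameters: `q ≠ 0` is not a root of unity, `d` is odd, the `kᵢ` are nonzero and
`k₀² = q^{-d-1}`. -/
structure EParam (q : F) (d : ℕ) (k₀ k₁ k₂ k₃ : F) : Prop where
  generic : Generic q
  odd : Odd d
  k₀_ne : k₀ ≠ 0
  k₁_ne : k₁ ≠ 0
  k₂_ne : k₂ ≠ 0
  k₃_ne : k₃ ≠ 0
  k₀_sq : k₀ ^ 2 = q ^ (-(d : ℤ) - 1)

/-- The standard basis vector `vᵢ` of `F^{d+1}` for `0 ≤ i ≤ d` (and `0` for `i > d`, a value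
which is not used in the formulas below). -/
def v (F : Type*) [Field F] (d i : ℕ) : Fin (d + 1) → F :=
  fun j => if (j : ℕ) = i then 1 else 0

/-- The vector `t₀ vᵢ`. -/
def t₀v (q : F) (d : ℕ) (k₀ : F) (i : ℕ) : Fin (d + 1) → F :=
  if i = 0 then k₀ • v F d 0
  else if i = d then k₀ • v F d d
  else if Even i then
    (k₀⁻¹ * (q ^ i)⁻¹ * (1 - q ^ i) * (1 - k₀ ^ 2 * q ^ i)) • v F d (i - 1) +
      (k₀ + k₀⁻¹ - k₀⁻¹ * (q ^ i)⁻¹) • v F d i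
  else (k₀⁻¹ * (q ^ (i + 1))⁻¹) • (v F d i - v F d (i + 1))

/-- The vector `t₁ vᵢ`. -/
def t₁v (q : F) (d : ℕ) (k₀ k₁ : F) (i : ℕ) : Fin (d + 1) → F :=
  if i = 0 then k₁ • v F d 0 + k₁⁻¹ • v F d 1
  else if Even i then
    (-k₁ * (1 - q ^ i) * (1 - k₀ ^ 2 * q ^ i)) • v F d (i - 1) + k₁ • v F d i +
      k₁⁻¹ • v F d (i + 1)
  else k₁⁻¹ • v F d i

/-- The vector `t₂ vᵢ`. -/
def t₂v (q : F) (d : ℕ) (k₀ k₁ k₂ k₃ : F) (i : ℕ) : Fin (d + 1) → F :=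
  if Even i then
    (k₀⁻¹ * k₁⁻¹ * k₃⁻¹ * (q ^ (i + 1))⁻¹) • (v F d i - v F d (i + 1))
  else
    ((k₀ * k₁ * k₃ * q ^ i - k₂) * (k₀ * k₁ * k₃ * q ^ i - k₂⁻¹) / (k₀ * k₁ * k₃ * q ^ i)) •
        v F d (i - 1) +
      (k₂ + k₂⁻¹ - k₀⁻¹ * k₁⁻¹ * k₃⁻¹ * (q ^ i)⁻¹) • v F d i

/-- The vector `t₃ vᵢ`. -/
def t₃v (q : F) (d : ℕ) (k₀ k₁ k₂ k₃ : F) (i : ℕ) : Fin (d + 1) → F :=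
  if Even i then k₃ • v F d i
  else if i = d then
    (-k₃⁻¹ * (k₀ * k₁ * k₃ * q ^ d - k₂) * (k₀ * k₁ * k₃ * q ^ d - k₂⁻¹)) • v F d (d - 1) +
      k₃⁻¹ • v F d d
  else
    (-k₃⁻¹ * (k₀ * k₁ * k₃ * q ^ i - k₂) * (k₀ * k₁ * k₃ * q ^ i - k₂⁻¹)) • v F d (i - 1) +
      k₃⁻¹ • v F d i + k₃ • v F d (i + 1)

/-- The endomorphism of `F^{d+1}` that sends `vᵢ` to `f i` for `i = 0,…,d`. -/
noncomputable def endo (d : ℕ) (f : ℕ → Fin (d + 1) → F) : Module.End F (Fin (d + 1) → F) :=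
  (Pi.basisFun F (Fin (d + 1))).constr F (fun i => f i)

/-- The endomorphisms by which `t₀, t₁, t₂, t₃` act on `E(k₀,k₁,k₂,k₃)`. -/
noncomputable def tE (q : F) (d : ℕ) (k₀ k₁ k₂ k₃ : F) :
    Fin 4 → Module.End F (Fin (d + 1) → F) :=
  ![endo d (t₀v q d k₀), endo d (t₁v q d k₀ k₁), endo d (t₂v q d k₀ k₁ k₂ k₃),
    endo d (t₃v q d k₀ k₁ k₂ k₃)]

/-- The endomorphisms by which the generators act: `tᵢ⁻¹ = (kᵢ + kᵢ⁻¹) - tᵢ`, that is,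
`cᵢ = tᵢ + tᵢ⁻¹` acts as multiplication by `kᵢ + kᵢ⁻¹`. -/
noncomputable def genE (q : F) (d : ℕ) (k₀ k₁ k₂ k₃ : F) :
    DAHAGen → Module.End F (Fin (d + 1) → F)
  | .t i => tE q d k₀ k₁ k₂ k₃ i
  | .tinv i => algebraMap F _ ((![k₀, k₁, k₂, k₃] i) + (![k₀, k₁, k₂, k₃] i)⁻¹) -
      tE q d k₀ k₁ k₂ k₃ i

theorem endo_v {d : ℕ} (f : ℕ → Fin (d + 1) → F) {i : ℕ} (hi : i ≤ d) :
    endo d f (v F d i) = f i := by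
  have : v F d i = Pi.basisFun F (Fin (d + 1)) ⟨i, by omega⟩ := by
    ext j; simp [v, Pi.single_apply, Fin.ext_iff]
  rw [this, endo, Module.Basis.constr_basis]

theorem v_zero {d i : ℕ} (hi : d < i) : v F d i = 0 := by
  ext j; have := j.2; simp [v]; omega

theorem end_ext {d : ℕ} {f g : Module.End F (Fin (d + 1) → F)}
    (h : ∀ i ≤ d, f (v F d i) = g (v F d i)) : f = g := by
  refine (Pi.basisFun F (Fin (d + 1))).ext fun i => ?_
  have : v F d i = Pi.basisFun F (Fin (d + 1)) i := by
    ext j; simp [v, Pi.single_apply, Fin.ext_iff]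
  rw [← this]; exact h i (by omega)

section Formulas

variable {q : F} {d : ℕ} {k₀ k₁ k₂ k₃ : F}

theorem EParam.k₀_sq' (h : EParam q d k₀ k₁ k₂ k₃) : k₀ ^ 2 * q ^ (d + 1) = 1 := by
  have h0 := h.generic.ne_zero
  rw [h.k₀_sq, ← zpow_natCast, ← zpow_add₀ h0]
  simp

/-- Uniform form of the action of `t₀` on odd basis vectors. -/
theorem t₀_odd (h : EParam q d k₀ k₁ k₂ k₃) {m : ℕ} (hm : 2 * m + 1 ≤ d) :
    endo d (t₀v q d k₀) (v F d (2 * m + 1)) =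
      (k₀⁻¹ * (q ^ (2 * m + 2))⁻¹) • (v F d (2 * m + 1) - v F d (2 * m + 2)) := by
  have h0 := h.generic.ne_zero
  have hk := h.k₀_ne
  rw [endo_v _ hm, t₀v, if_neg (by omega)]
  split_ifs with h1 h2
  · rw [v_zero (i := 2 * m + 2) (by omega), sub_zero, h1]
    congr 1
    have := h.k₀_sq'
    rw [← h1] at this
    field_simp
    linear_combination this
  · exact absurd h2 (by simp [parity_simps])
  · rfl

theorem t₀_zero : endo d (t₀v q d k₀) (v F d 0) = k₀ • v F d 0 := by
  rw [endo_v _ (by omega), t₀v, if_pos rfl]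

theorem t₀_even (h : EParam q d k₀ k₁ k₂ k₃) {m : ℕ} (hm : 2 * m + 2 ≤ d) :
    endo d (t₀v q d k₀) (v F d (2 * m + 2)) =
      (k₀⁻¹ * (q ^ (2 * m + 2))⁻¹ * (1 - q ^ (2 * m + 2)) * (1 - k₀ ^ 2 * q ^ (2 * m + 2))) •
        v F d (2 * m + 1) + (k₀ + k₀⁻¹ - k₀⁻¹ * (q ^ (2 * m + 2))⁻¹) • v F d (2 * m + 2) := by
  have ho := h.odd
  rw [endo_v _ hm, t₀v, if_neg (by omega), if_neg (by grind), if_pos (by simp [parity_simps])]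
  rfl

theorem t₁_zero : endo d (t₁v q d k₀ k₁) (v F d 0) = k₁ • v F d 0 + k₁⁻¹ • v F d 1 := by
  rw [endo_v _ (by omega), t₁v, if_pos rfl]

theorem t₁_even {m : ℕ} (hm : 2 * m + 2 ≤ d) :
    endo d (t₁v q d k₀ k₁) (v F d (2 * m + 2)) =
      (-k₁ * (1 - q ^ (2 * m + 2)) * (1 - k₀ ^ 2 * q ^ (2 * m + 2))) • v F d (2 * m + 1) +
        k₁ • v F d (2 * m + 2) + k₁⁻¹ • v F d (2 * m + 3) := by
  rw [endo_v _ hm, t₁v, if_neg (by omega), if_pos (by simp [parity_simps])]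
  rfl

theorem t₁_odd {m : ℕ} (hm : 2 * m + 1 ≤ d) :
    endo d (t₁v q d k₀ k₁) (v F d (2 * m + 1)) = k₁⁻¹ • v F d (2 * m + 1) := by
  rw [endo_v _ hm, t₁v, if_neg (by omega), if_neg (by simp [parity_simps])]

theorem t₁_one (hd : 1 ≤ d) : endo d (t₁v q d k₀ k₁) (v F d 1) = k₁⁻¹ • v F d 1 :=
  t₁_odd (m := 0) hd

theorem t₁_odd' {m : ℕ} (hm : 2 * m + 3 ≤ d) :
    endo d (t₁v q d k₀ k₁) (v F d (2 * m + 3)) = k₁⁻¹ • v F d (2 * m + 3) :=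
  t₁_odd (m := m + 1) hm

theorem t₂_even {m : ℕ} (hm : 2 * m ≤ d) :
    endo d (t₂v q d k₀ k₁ k₂ k₃) (v F d (2 * m)) =
      (k₀⁻¹ * k₁⁻¹ * k₃⁻¹ * (q ^ (2 * m + 1))⁻¹) • (v F d (2 * m) - v F d (2 * m + 1)) := by
  rw [endo_v _ hm, t₂v, if_pos (by simp)]

theorem t₂_odd {m : ℕ} (hm : 2 * m + 1 ≤ d) :
    endo d (t₂v q d k₀ k₁ k₂ k₃) (v F d (2 * m + 1)) =
      ((k₀ * k₁ * k₃ * q ^ (2 * m + 1) - k₂) * (k₀ * k₁ * k₃ * q ^ (2 * m + 1) - k₂⁻¹) /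
        (k₀ * k₁ * k₃ * q ^ (2 * m + 1))) • v F d (2 * m) +
      (k₂ + k₂⁻¹ - k₀⁻¹ * k₁⁻¹ * k₃⁻¹ * (q ^ (2 * m + 1))⁻¹) • v F d (2 * m + 1) := by
  rw [endo_v _ hm, t₂v, if_neg (by simp [parity_simps])]
  rfl

theorem t₃_even {m : ℕ} (hm : 2 * m ≤ d) :
    endo d (t₃v q d k₀ k₁ k₂ k₃) (v F d (2 * m)) = k₃ • v F d (2 * m) := by
  rw [endo_v _ hm, t₃v, if_pos (by simp)]

theorem t₃_odd {m : ℕ} (hm : 2 * m + 1 ≤ d) :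
    endo d (t₃v q d k₀ k₁ k₂ k₃) (v F d (2 * m + 1)) =
      (-k₃⁻¹ * (k₀ * k₁ * k₃ * q ^ (2 * m + 1) - k₂) *
        (k₀ * k₁ * k₃ * q ^ (2 * m + 1) - k₂⁻¹)) • v F d (2 * m) +
      k₃⁻¹ • v F d (2 * m + 1) + k₃ • v F d (2 * m + 2) := by
  rw [endo_v _ hm, t₃v, if_neg (by simp [parity_simps])]
  split_ifs with h1
  · rw [v_zero (i := 2 * m + 2) (by omega), smul_zero, add_zero, ← h1]
    rfl
  · rfl

/-- The quadratic relation of `tᵢ` on `E(k₀,k₁,k₂,k₃)`. -/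
theorem tE_quad (h : EParam q d k₀ k₁ k₂ k₃) (i : Fin 4) :
    tE q d k₀ k₁ k₂ k₃ i * tE q d k₀ k₁ k₂ k₃ i =
      ((![k₀, k₁, k₂, k₃] i) + (![k₀, k₁, k₂, k₃] i)⁻¹) • tE q d k₀ k₁ k₂ k₃ i - 1 := by
  have hq := h.generic.ne_zero
  have h0 := h.k₀_ne
  have h1 := h.k₁_ne
  have h2 := h.k₂_ne
  have h3 := h.k₃_ne
  have ho := h.odd
  refine end_ext fun j hj => ?_
  obtain ⟨m, rfl | rfl⟩ := Nat.even_or_odd' j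
  · have hj' : 2 * m + 1 ≤ d := by grind
    fin_cases i <;>
      simp only [tE, Module.End.mul_apply, LinearMap.sub_apply, LinearMap.smul_apply,
        Module.End.one_apply, Fin.zero_eta, Fin.mk_one, Fin.reduceFinMk, Matrix.cons_val]
    · rcases m with _ | m
      · simp only [mul_zero, t₀_zero, map_smul]
        match_scalars
        field_simp; ring
      · simp only [Nat.mul_succ, t₀_even h hj, t₀_odd h (m := m) (by omega), map_smul, map_add]
        match_scalars <;> field_simp <;> ring
    · rcases m with _ | m
      · simp only [mul_zero, t₁_zero, map_smul, map_add]
        rw [t₁_one hj']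
        match_scalars <;> field_simp <;> ring
      · have ho' : 2 * m + 1 ≤ d := by omega
        simp only [Nat.mul_succ, t₁_even hj, t₁_odd ho', t₁_odd' hj', map_smul, map_add]
        match_scalars <;> field_simp <;> ring
    · simp only [t₂_even hj, t₂_odd hj', map_smul, map_sub]
      match_scalars <;> field_simp <;> ring
    · simp only [t₃_even hj, map_smul]
      match_scalars <;> field_simp <;> ring
  · have hj' : 2 * m ≤ d := by omega
    fin_cases i <;>
      simp only [tE, Module.End.mul_apply, LinearMap.sub_apply, LinearMap.smul_apply,
        Module.End.one_apply, Fin.zero_eta, Fin.mk_one, Fin.reduceFinMk, Matrix.cons_val]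
    · rcases Nat.lt_or_ge d (2 * m + 2) with hd | hd
      · have hm : d = 2 * m + 1 := by omega
        have hs := h.k₀_sq'
        simp only [t₀_odd h hj, v_zero hd, sub_zero, map_smul]
        rw [hm] at hs
        match_scalars
        field_simp
        grind
      · simp only [t₀_odd h hj, t₀_even h hd, map_smul, map_sub]
        match_scalars <;> field_simp <;> ring
    · simp only [t₁_odd hj, map_smul]
      match_scalars <;> field_simp <;> ring
    · simp only [t₂_even hj', t₂_odd hj, map_smul, map_add]
      match_scalars <;> field_simp <;> ring
    · rcases Nat.lt_or_ge d (2 * m + 2) with hd | hd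
      · simp only [t₃_odd hj, t₃_even hj', v_zero hd, smul_zero, add_zero, map_smul, map_add]
        match_scalars <;> field_simp <;> ring
      · simp only [t₃_odd hj, t₃_even hj', map_smul, map_add]
        rw [show 2 * m + 2 = 2 * (m + 1) by ring, t₃_even (by omega)]
        match_scalars <;> field_simp <;> ring

/-- The relation `t₀t₁t₂t₃ = q⁻¹` on `E(k₀,k₁,k₂,k₃)`. -/
theorem tE_prod (h : EParam q d k₀ k₁ k₂ k₃) :
    tE q d k₀ k₁ k₂ k₃ 0 * tE q d k₀ k₁ k₂ k₃ 1 * tE q d k₀ k₁ k₂ k₃ 2 *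
      tE q d k₀ k₁ k₂ k₃ 3 = q⁻¹ • 1 := by
  have hq := h.generic.ne_zero
  have h0 := h.k₀_ne
  have h1 := h.k₁_ne
  have h2 := h.k₂_ne
  have h3 := h.k₃_ne
  have ho := h.odd
  have E (m : ℕ) (hj : 2 * m ≤ d) :
      endo d (t₀v q d k₀) (endo d (t₁v q d k₀ k₁)
        (endo d (t₂v q d k₀ k₁ k₂ k₃) (v F d (2 * m)))) = (q⁻¹ * k₃⁻¹) • v F d (2 * m) := by
    have hj' : 2 * m + 1 ≤ d := by grind
    rcases m with _ | m
    · rw [t₂_even hj]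
      simp only [mul_zero, map_smul, map_sub, t₁_zero, map_add]
      rw [zero_add, t₁_one hj', map_smul, t₀_zero]
      match_scalars <;> field_simp <;> ring
    · rw [t₂_even hj]
      simp only [Nat.mul_succ, map_smul, map_sub, t₁_even hj, map_add]
      rw [t₁_odd' hj', map_smul, t₀_even h hj, t₀_odd h (m := m) (by omega)]
      match_scalars <;> field_simp <;> ring
  have G (m : ℕ) (hj : 2 * m + 1 ≤ d) :
      endo d (t₀v q d k₀) (endo d (t₁v q d k₀ k₁) (v F d (2 * m))) =
        (k₀ * k₁ * q ^ (2 * m)) • v F d (2 * m) +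
          k₁⁻¹ • endo d (t₀v q d k₀) (v F d (2 * m + 1)) := by
    have e := E m (by omega)
    rw [t₂_even (by omega)] at e
    simp only [map_smul, map_sub, t₁_odd hj] at e
    have e' := congrArg (fun x => (k₀ * k₁ * k₃ * q ^ (2 * m + 1)) • x) e
    simp only [smul_smul] at e'
    rw [show k₀ * k₁ * k₃ * q ^ (2 * m + 1) * (k₀⁻¹ * k₁⁻¹ * k₃⁻¹ * (q ^ (2 * m + 1))⁻¹) = 1 by
      field_simp, one_smul, sub_eq_iff_eq_add] at e'
    rw [e']
    congr 2
    field_simp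
    ring
  refine end_ext fun j hj => ?_
  simp only [tE, Module.End.mul_apply, LinearMap.smul_apply, Module.End.one_apply,
    Matrix.cons_val]
  obtain ⟨m, rfl | rfl⟩ := Nat.even_or_odd' j
  · rw [t₃_even hj]
    simp only [map_smul, E m hj]
    match_scalars
    field_simp
  · have hj' : 2 * m ≤ d := by omega
    rw [t₃_odd hj]
    simp only [map_smul, map_add, E m hj', t₂_odd hj]
    rw [G m hj, t₁_odd hj, map_smul, t₀_odd h hj]
    rcases Nat.lt_or_ge d (2 * m + 2) with hd | hd
    · simp only [v_zero hd, sub_zero, smul_zero, add_zero, map_zero]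
      match_scalars <;> field_simp <;> ring
    · rw [show 2 * m + 2 = 2 * (m + 1) by ring, E (m + 1) (by omega)]
      match_scalars <;> field_simp <;> ring

end Formulas

theorem genE_rel {q : F} {d : ℕ} {k₀ k₁ k₂ k₃ : F} (h : EParam q d k₀ k₁ k₂ k₃)
    ⦃x y : FreeAlgebra F DAHAGen⦄ (r : DAHARel q x y) :
    FreeAlgebra.lift F (genE q d k₀ k₁ k₂ k₃) x =
      FreeAlgebra.lift F (genE q d k₀ k₁ k₂ k₃) y := by
  cases r with
  | mul_inv i =>
    simp only [map_mul, map_one, FreeAlgebra.lift_ι_apply, genE, mul_sub, tE_quad h i]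
    rw [← Algebra.commutes, ← Algebra.smul_def, sub_sub_cancel]
  | inv_mul i =>
    simp only [map_mul, map_one, FreeAlgebra.lift_ι_apply, genE, sub_mul, tE_quad h i]
    rw [← Algebra.smul_def, sub_sub_cancel]
  | central i x =>
    simp only [map_mul, map_add, FreeAlgebra.lift_ι_apply, genE, add_sub_cancel]
    rw [← map_add]
    exact Algebra.commutes (R := F) (A := Module.End F (Fin (d + 1) → F)) _ _
  | prod =>
    simp only [map_mul, FreeAlgebra.lift_ι_apply, genE, AlgHom.commutes]
    rw [tE_prod h, Algebra.algebraMap_eq_smul_one]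

/-- The representation of `ℌ_q` on `E(k₀,k₁,k₂,k₃)`. -/
noncomputable def repE {q : F} {d : ℕ} {k₀ k₁ k₂ k₃ : F} (h : EParam q d k₀ k₁ k₂ k₃) :
    DAHA q →ₐ[F] Module.End F (Fin (d + 1) → F) :=
  RingQuot.liftAlgHom F ⟨FreeAlgebra.lift F (genE q d k₀ k₁ k₂ k₃), genE_rel h⟩

/-- The underlying space `F^{d+1}` of the `ℌ_q`-module `E(k₀,k₁,k₂,k₃)`. -/
def E {q : F} {d : ℕ} {k₀ k₁ k₂ k₃ : F} (_ : EParam q d k₀ k₁ k₂ k₃) : Type _ :=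
  Fin (d + 1) → F

variable {q : F} {d : ℕ} {k₀ k₁ k₂ k₃ : F} (h : EParam q d k₀ k₁ k₂ k₃)

instance : AddCommGroup (E h) := inferInstanceAs (AddCommGroup (Fin (d + 1) → F))

instance : Module F (E h) := inferInstanceAs (Module F (Fin (d + 1) → F))

/-- The action of `ℌ_q` on `E(k₀,k₁,k₂,k₃)`. -/
noncomputable instance : Module (DAHA q) (E h) :=
  Module.compHom (Fin (d + 1) → F) (repE h).toRingHom

theorem smul_def_E (x : DAHA q) (w : E h) : x • w = repE h x w := rfl

instance : IsScalarTower F (DAHA q) (E h) where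
  smul_assoc a x w := by rw [smul_def_E, smul_def_E, map_smul]; rfl

/-- The action of `△_q` on `E(k₀,k₁,k₂,k₃)`, pulled back along `ζ`. -/
noncomputable instance : Module (AW q) (E h) :=
  Module.compHom (E h) (zeta h.generic).toRingHom

theorem aw_smul_def (a : AW q) (w : E h) : a • w = zeta h.generic a • w := rfl

/-- The `t₀`-eigenspace `E(k₀,k₁,k₂,k₃)(θ) = {w | t₀ w = θ w}`, as a `△_q`-submodule. -/
noncomputable def eigen (θ : F) : Submodule (AW q) (E h) where
  carrier := {w | t q 0 • w = θ • w}
  add_mem' {a b} ha hb := by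
    simp only [Set.mem_ofPred_eq] at *
    rw [smul_add, ha, hb, smul_add]
  zero_mem' := by simp
  smul_mem' a w hw := by
    simp only [Set.mem_ofPred_eq] at *
    rw [aw_smul_def, smul_smul, zeta_comm_t0, mul_smul, hw, ← algebraMap_smul (DAHA q) θ w,
      smul_smul, ← Algebra.commutes, mul_smul, algebraMap_smul]

end Even

end DahaAW

open DahaAW

/-!
Let `V` be an `ℌ_q`-module on which each `tᵢ + tᵢ⁻¹` acts as a scalar, and let `W` be a
`△_q`-submodule of the eigenspace `V(θ)` of `t₀`. Stability under `A, B, C` amounts to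
`t₀tᵢw ≡ θ⁻¹tᵢw` modulo `W` for `w ∈ W` and `i ≠ 0`. Together with `t₀t₁t₂t₃ = q⁻¹` this makes
`U = ∑ tᵢW` an `ℌ_q`-submodule, and `t₀ - θ⁻¹` maps `U` into `W`. If `V` is irreducible and `W ≠ 0`,
then `U = V`; as `t₀ - θ⁻¹` is the nonzero scalar `θ - θ⁻¹` on `V(θ)`, it follows that `W = V(θ)`.

So `E` is the direct sum of `E(k₀)` and `E(k₀⁻¹)`, each of which is simple or zero. A
`△_q`-submodule other than `0, E(k₀), E(k₀⁻¹), E` would be a complement of both summands and make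
them isomorphic, which is impossible because `dim E(k₀) > dim E(k₀⁻¹)`.
-/

namespace DahaAW

section Lattice

variable {L : Type*} [Lattice L] [BoundedOrder L] {a b : L}

theorem eq_bot_or_eq_or_eq_or_eq_top_of_isCompl_of_isAtom [IsModularLattice L]
    (hab : IsCompl a b) (ha : IsAtom a) (hb : IsAtom b)
    (hno : ∀ x, IsCompl x a → ¬IsCompl x b) (x : L) :
    x = ⊥ ∨ x = a ∨ x = b ∨ x = ⊤ := by
  have ha' : IsCoatom a := hab.symm.isAtom_iff_isCoatom.1 hb
  have hb' : IsCoatom b := hab.isAtom_iff_isCoatom.1 ha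
  have isCompl_or {y : L} (hy : IsAtom y) (hy' : IsCoatom y) :
      x = ⊥ ∨ x = y ∨ x = ⊤ ∨ IsCompl x y := by
    by_cases hyx : y ≤ x
    · exact (hy'.le_iff.1 hyx).elim (fun e => .inr (.inr (.inl e))) fun e => .inr (.inl e)
    by_cases hxy : x ≤ y
    · exact (hy.le_iff.1 hxy).elim .inl fun e => .inr (.inl e)
    exact .inr (.inr (.inr (IsCompl.symm
      ⟨hy.not_le_iff_disjoint.1 hyx, hy'.not_le_iff_codisjoint.1 hxy⟩)))
  have := isCompl_or ha ha'
  have := isCompl_or hb hb'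
  have := hno x
  tauto

theorem exists_orderIso_bool_prod_of_isCompl (hab : IsCompl a b) (ha : a ≠ ⊥) (hb : b ≠ ⊥)
    (hall : ∀ x, x = ⊥ ∨ x = a ∨ x = b ∨ x = ⊤) :
    ∃ e : Bool × Bool ≃o L, e (false, false) = ⊥ ∧ e (true, false) = a ∧
      e (false, true) = b ∧ e (true, true) = ⊤ := by
  have not_ab : ¬a ≤ b := fun hle => ha (hab.disjoint.eq_bot_of_le hle)
  have not_ba : ¬b ≤ a := fun hle => hb (hab.symm.disjoint.eq_bot_of_le hle)
  have not_top_a : ¬(⊤ : L) ≤ a := fun hle => not_ba (le_top.trans hle)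
  have not_top_b : ¬(⊤ : L) ≤ b := fun hle => not_ab (le_top.trans hle)
  have not_top_bot : ¬(⊤ : L) ≤ ⊥ := fun hle => not_top_a (hle.trans bot_le)
  let f : Bool × Bool → L := fun p => cond p.1 (cond p.2 ⊤ a) (cond p.2 b ⊥)
  have hf : ∀ p p', f p ≤ f p' ↔ p ≤ p' := by
    rintro ⟨_ | _, _ | _⟩ ⟨_ | _, _ | _⟩ <;> simp_all [f]
  refine ⟨RelIso.ofSurjective (OrderEmbedding.ofMapLEIff f hf) fun x => ?_, rfl, rfl, rfl, rfl⟩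
  rcases hall x with rfl | rfl | rfl | rfl
  exacts [⟨(false, false), rfl⟩, ⟨(true, false), rfl⟩, ⟨(false, true), rfl⟩, ⟨(true, true), rfl⟩]

end Lattice

theorem isCompl_eigenspace_of_sub_smul_mem {K V : Type*} [Field K] [AddCommGroup V] [Module K V]
    {f : Module.End K V} {a b : K} (hab : a ≠ b) (hf : ∀ x, f x - b • x ∈ f.eigenspace a) :
    IsCompl (f.eigenspace a) (f.eigenspace b) := by
  have hf' (x : V) : f x - a • x ∈ f.eigenspace b := by
    have := Module.End.mem_eigenspace_iff.1 (hf x)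
    rw [map_sub, map_smul] at this
    rw [Module.End.mem_eigenspace_iff, map_sub, map_smul, sub_eq_iff_eq_add.1 this]
    module
  refine ⟨f.disjoint_genEigenspace hab 1 1, codisjoint_iff_le_sup.2 fun x _ => ?_⟩
  have decomposition : x = (a - b)⁻¹ • (f x - b • x) + -(a - b)⁻¹ • (f x - a • x) := by
    match_scalars <;> field [sub_ne_zero.2 hab]
  rw [decomposition]
  exact Submodule.add_mem_sup (Submodule.smul_mem _ _ (hf x)) (Submodule.smul_mem _ _ (hf' x))

section Words

variable {F : Type*} [Field F] {q : F}

theorem t_two_eq : t q 2 = q⁻¹ • (tinv q 1 * (tinv q 0 * tinv q 3)) := by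
  calc t q 2 = tinv q 1 * (tinv q 0 * t q 0) * t q 1 * t q 2 * (t q 3 * tinv q 3) := by
        rw [tinv_mul_t, mul_one, tinv_mul_t, one_mul, t_mul_tinv, mul_one]
    _ = tinv q 1 * tinv q 0 * (t q 0 * t q 1 * t q 2 * t q 3) * tinv q 3 := by
        simp only [mul_assoc]
    _ = q⁻¹ • (tinv q 1 * (tinv q 0 * tinv q 3)) := by
        rw [t_prod, Algebra.algebraMap_eq_smul_one, mul_smul_comm, mul_one, smul_mul_assoc,
          mul_assoc]

theorem tinv_two_eq (hq : q ≠ 0) : tinv q 2 = q • (t q 3 * (t q 0 * t q 1)) := by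
  refine left_inv_eq_right_inv (tinv_mul_t q 2) ?_
  calc t q 2 * (q • (t q 3 * (t q 0 * t q 1)))
      = tinv q 1 * (tinv q 0 * (tinv q 3 * t q 3) * t q 0) * t q 1 := by
        rw [t_two_eq, mul_smul_comm, smul_mul_assoc, smul_smul, mul_inv_cancel₀ hq, one_smul]
        simp only [mul_assoc]
    _ = 1 := by rw [tinv_mul_t, mul_one, tinv_mul_t, mul_one, tinv_mul_t]

theorem DAHA.induction {p : DAHA q → Prop} (algebraMap : ∀ r : F, p (algebraMap F _ r))
    (t : ∀ i, p (t q i)) (tinv : ∀ i, p (tinv q i)) (add : ∀ a b, p a → p b → p (a + b))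
    (mul : ∀ a b, p a → p b → p (a * b)) (a : DAHA q) : p a := by
  obtain ⟨y, rfl⟩ := RingQuot.mkAlgHom_surjective F (DAHARel q) a
  induction y using FreeAlgebra.induction with
  | grade0 r => rw [AlgHom.commutes]; exact algebraMap r
  | grade1 g =>
    cases g with
    | t i => exact t i
    | tinv i => exact tinv i
  | mul a b ha hb => rw [map_mul]; exact mul _ _ ha hb
  | add a b ha hb => rw [map_add]; exact add _ _ ha hb

end Words

section CentralCharacter

open scoped Pointwise

variable {F : Type*} [Field F] {q : F} {V : Type*} [AddCommGroup V] [Module F V]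
  [Module (DAHA q) V]

/-- `V` has central character `c`: each central element `tᵢ + tᵢ⁻¹` acts on the `ℌ_q`-module `V`
as the scalar `c i`. -/
def HasCentralCharacter (q : F) (V : Type*) [AddCommGroup V] [Module F V] [Module (DAHA q) V]
    (c : Fin 4 → F) : Prop :=
  ∀ i (x : V), (t q i + tinv q i) • x = c i • x

variable {c : Fin 4 → F} {U W : Submodule F V} {w x : V} {θ : F}

theorem HasCentralCharacter.tinv_smul (hc : HasCentralCharacter q V c) (i : Fin 4) (x : V) :
    tinv q i • x = c i • x - t q i • x := by
  rw [← hc i x, add_smul, add_sub_cancel_left]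

theorem HasCentralCharacter.tinv_smul_mem_iff (hc : HasCentralCharacter q V c) (hx : x ∈ U)
    (i : Fin 4) : tinv q i • x ∈ U ↔ t q i • x ∈ U := by
  rw [hc.tinv_smul, U.sub_mem_iff_right (U.smul_mem _ hx)]

/-- The subspace `W` of the `ℌ_q`-module `V` is a `△_q`-submodule of `V(θ)`. Stability under `△_q`
is expressed through the images of the generators `A, B, C` in `ℌ_q`, so that no `△_q`-module
structure on `V` has to be chosen. -/
structure IsEigenSubmodule (q : F) {V : Type*} [AddCommGroup V] [Module F V] [Module (DAHA q) V]
    (W : Submodule F V) (θ : F) : Prop where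
  zetaGen_smul_mem : ∀ g, ∀ w ∈ W, zetaGen q g • w ∈ W
  t_zero_smul : ∀ w ∈ W, t q 0 • w = θ • w

theorem t_smul_mem_range_smul (hw : w ∈ W) (i : Fin 4) : t q i • w ∈ Set.range (t q) • W :=
  Submodule.mem_set_smul_of_mem_mem ⟨i, rfl⟩ hw

namespace IsEigenSubmodule

theorem bracket_smul_mem (hW : IsEigenSubmodule q W θ) (hw : w ∈ W) {i : Fin 4} (hi : i ≠ 0) :
    (t q i * t q 0 + tinv q 0 * tinv q i) • w ∈ W := by
  fin_cases i
  exacts [absurd rfl hi, hW.zetaGen_smul_mem .A w hw, hW.zetaGen_smul_mem .C w hw,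
    hW.zetaGen_smul_mem .B w hw]

theorem le_range_smul (hW : IsEigenSubmodule q W θ) (hθ : θ ≠ 0) : W ≤ Set.range (t q) • W :=
  fun w hw => by
    have := t_smul_mem_range_smul (q := q) hw 0
    rwa [hW.t_zero_smul w hw, Submodule.smul_mem_iff _ hθ] at this

theorem tinv_smul_mem_range_smul (hW : IsEigenSubmodule q W θ) (hc : HasCentralCharacter q V c)
    (hθ : θ ≠ 0) (hw : w ∈ W) (i : Fin 4) : tinv q i • w ∈ Set.range (t q) • W :=
  (hc.tinv_smul_mem_iff (hW.le_range_smul hθ hw) i).2 (t_smul_mem_range_smul hw i)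

theorem t_smul_t_zero_smul_mem (hW : IsEigenSubmodule q W θ) (hw : w ∈ W) (i : Fin 4) :
    t q i • t q 0 • w ∈ Set.range (t q) • W := by
  rw [hW.t_zero_smul w hw]
  exact t_smul_mem_range_smul (W.smul_mem θ hw) i

theorem t_smul_t_smul_self_mem (hW : IsEigenSubmodule q W θ) (hc : HasCentralCharacter q V c)
    (hθ : θ ≠ 0) (hw : w ∈ W) (i : Fin 4) : t q i • t q i • w ∈ Set.range (t q) • W := by
  rw [← hc.tinv_smul_mem_iff (t_smul_mem_range_smul hw i), ← mul_smul, tinv_mul_t, one_smul]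
  exact hW.le_range_smul hθ hw

end IsEigenSubmodule

variable [IsScalarTower F (DAHA q) V]

theorem HasCentralCharacter.tinv_smul_tinv_smul_mem_iff (hc : HasCentralCharacter q V c)
    (hx : x ∈ U) {i j : Fin 4} (hi : t q i • x ∈ U) (hj : t q j • x ∈ U) :
    tinv q i • tinv q j • x ∈ U ↔ t q i • t q j • x ∈ U := by
  rw [hc.tinv_smul_mem_iff ((hc.tinv_smul_mem_iff hx j).2 hj), hc.tinv_smul j, smul_sub,
    smul_comm, U.sub_mem_iff_right (U.smul_mem _ hi)]

theorem HasCentralCharacter.smul_mem (hc : HasCentralCharacter q V c)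
    (hU : ∀ i ≠ 2, ∀ x ∈ U, t q i • x ∈ U) (a : DAHA q) : ∀ x ∈ U, a • x ∈ U := by
  have tinv_mem : ∀ i ≠ 2, ∀ x ∈ U, tinv q i • x ∈ U := fun i hi x hx =>
    (hc.tinv_smul_mem_iff hx i).2 (hU i hi x hx)
  have t_mem (i : Fin 4) : ∀ x ∈ U, t q i • x ∈ U := by
    rcases eq_or_ne i 2 with rfl | hi
    · intro x hx
      rw [t_two_eq, smul_assoc, mul_smul, mul_smul]
      exact U.smul_mem _ (tinv_mem 1 (by decide) _ (tinv_mem 0 (by decide) _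
        (tinv_mem 3 (by decide) x hx)))
    · exact hU i hi
  induction a using DAHA.induction with
  | algebraMap r => exact fun x hx => by rw [algebraMap_smul]; exact U.smul_mem r hx
  | t i => exact t_mem i
  | tinv i => exact fun x hx => (hc.tinv_smul_mem_iff hx i).2 (t_mem i x hx)
  | add a b ha hb => exact fun x hx => by rw [add_smul]; exact U.add_mem (ha x hx) (hb x hx)
  | mul a b ha hb => exact fun x hx => by rw [mul_smul]; exact ha _ (hb x hx)

theorem HasCentralCharacter.eq_top_of_t_smul_mem [IsSimpleModule (DAHA q) V]
    (hc : HasCentralCharacter q V c) (hU : ∀ i ≠ 2, ∀ x ∈ U, t q i • x ∈ U) (hne : U ≠ ⊥) :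
    U = ⊤ := by
  let U' : Submodule (DAHA q) V :=
    { U.toAddSubmonoid with smul_mem' := fun a x hx => hc.smul_mem hU a x hx }
  have hU' : U'.restrictScalars F = U := rfl
  rcases eq_bot_or_eq_top U' with h | h
  · rw [h, Submodule.restrictScalars_bot] at hU'
    exact absurd hU'.symm hne
  · rw [← hU', h, Submodule.restrictScalars_top]

/-- The eigenspace `V(θ) = {x ∈ V | t₀x = θx}` of an `ℌ_q`-module `V`. -/
noncomputable def tZeroEigenspace (q : F) (V : Type*) [AddCommGroup V] [Module F V]
    [Module (DAHA q) V] [IsScalarTower F (DAHA q) V] (θ : F) : Submodule F V :=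
  (Algebra.lsmul F F V (t q 0)).eigenspace θ

theorem mem_tZeroEigenspace : x ∈ tZeroEigenspace q V θ ↔ t q 0 • x = θ • x :=
  Module.End.mem_eigenspace_iff

theorem HasCentralCharacter.t_zero_smul_sub_mem_tZeroEigenspace (hc : HasCentralCharacter q V c)
    (hθ : θ ≠ 0) (hcθ : c 0 = θ + θ⁻¹) (x : V) :
    t q 0 • x - θ⁻¹ • x ∈ tZeroEigenspace q V θ := by
  have quadratic : t q 0 • t q 0 • x = (θ + θ⁻¹) • t q 0 • x - x := by
    have := hc.tinv_smul 0 (t q 0 • x)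
    rw [← mul_smul (tinv q 0), tinv_mul_t, one_smul, hcθ] at this
    exact eq_sub_of_add_eq (eq_sub_iff_add_eq'.1 this)
  rw [mem_tZeroEigenspace, smul_sub, quadratic, smul_comm (t q 0) θ⁻¹ x]
  generalize t q 0 • x = y
  match_scalars <;> field

theorem HasCentralCharacter.isCompl_tZeroEigenspace (hc : HasCentralCharacter q V c)
    (hθ : θ ≠ 0) (hθ' : θ ≠ θ⁻¹) (hcθ : c 0 = θ + θ⁻¹) :
    IsCompl (tZeroEigenspace q V θ) (tZeroEigenspace q V θ⁻¹) :=
  isCompl_eigenspace_of_sub_smul_mem hθ' (hc.t_zero_smul_sub_mem_tZeroEigenspace hθ hcθ)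


namespace IsEigenSubmodule

theorem t_zero_smul_t_smul_sub_mem (hW : IsEigenSubmodule q W θ) (hc : HasCentralCharacter q V c)
    (hcθ : c 0 = θ + θ⁻¹) (hw : w ∈ W) {i : Fin 4} (hi : i ≠ 0) :
    t q 0 • t q i • w - θ⁻¹ • t q i • w ∈ W := by
  have bracket_eq : (t q i * t q 0 + tinv q 0 * tinv q i) • w =
      t q 0 • t q i • w - θ⁻¹ • t q i • w + (c i * θ⁻¹) • w := by
    rw [add_smul, mul_smul, mul_smul, hc.tinv_smul i, hc.tinv_smul 0, hcθ, smul_sub (t q 0),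
      smul_comm (t q 0) (c i) w, hW.t_zero_smul w hw, smul_comm (t q i) θ w]
    generalize t q 0 • t q i • w = y
    generalize t q i • w = x
    module
  have := hW.bracket_smul_mem hw hi
  rwa [bracket_eq, W.add_mem_iff_left (W.smul_mem _ hw)] at this

theorem t_zero_smul_sub_mem (hW : IsEigenSubmodule q W θ) (hc : HasCentralCharacter q V c)
    (hcθ : c 0 = θ + θ⁻¹) (hx : x ∈ Set.range (t q) • W) : t q 0 • x - θ⁻¹ • x ∈ W := by
  let f : Module.End F V := Algebra.lsmul F F V (t q 0) - θ⁻¹ • 1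
  suffices Set.range (t q) • W ≤ W.comap f from this hx
  refine Submodule.set_smul_le _ _ _ ?_
  rintro _ w ⟨i, rfl⟩ hw
  change t q 0 • t q i • w - θ⁻¹ • t q i • w ∈ W
  rcases eq_or_ne i 0 with rfl | hi
  · simp only [hW.t_zero_smul w hw, hW.t_zero_smul _ (W.smul_mem θ hw)]
    exact W.sub_mem (W.smul_mem _ (W.smul_mem _ hw)) (W.smul_mem _ (W.smul_mem _ hw))
  · exact hW.t_zero_smul_t_smul_sub_mem hc hcθ hw hi

theorem t_zero_smul_mem (hW : IsEigenSubmodule q W θ) (hc : HasCentralCharacter q V c)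
    (hθ : θ ≠ 0) (hcθ : c 0 = θ + θ⁻¹) (hx : x ∈ Set.range (t q) • W) :
    t q 0 • x ∈ Set.range (t q) • W :=
  (Submodule.sub_mem_iff_left _ (Submodule.smul_mem _ _ hx)).1
    (hW.le_range_smul hθ (hW.t_zero_smul_sub_mem hc hcθ hx))

theorem t_one_smul_t_two_smul_mem (hW : IsEigenSubmodule q W θ) (hc : HasCentralCharacter q V c)
    (hθ : θ ≠ 0) (hcθ : c 0 = θ + θ⁻¹) (hw : w ∈ W) :
    t q 1 • t q 2 • w ∈ Set.range (t q) • W := by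
  have word : t q 1 • t q 2 • w = q⁻¹ • tinv q 0 • tinv q 3 • w := by
    rw [← mul_smul, t_two_eq, mul_smul_comm, ← mul_assoc, t_mul_tinv, one_mul, smul_assoc,
      mul_smul]
  have ht₃ := hW.tinv_smul_mem_range_smul hc hθ hw 3
  rw [word]
  exact Submodule.smul_mem _ _ ((hc.tinv_smul_mem_iff ht₃ 0).2 (hW.t_zero_smul_mem hc hθ hcθ ht₃))

theorem t_one_smul_t_three_smul_mem (hW : IsEigenSubmodule q W θ)
    (hc : HasCentralCharacter q V c) (hq : q ≠ 0) (hθ : θ ≠ 0) (hw : w ∈ W) :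
    t q 1 • t q 3 • w ∈ Set.range (t q) • W := by
  have word : tinv q 1 • tinv q 0 • tinv q 3 • w = q • t q 2 • w := by
    rw [t_two_eq, smul_assoc, smul_inv_smul₀ hq, mul_smul, mul_smul]
  have bracket := hW.tinv_smul_mem_range_smul hc hθ
    (hW.bracket_smul_mem hw (i := 3) (by decide)) 1
  rw [add_smul, mul_smul, mul_smul, smul_add, word, Submodule.add_mem_iff_left _
    (Submodule.smul_mem _ _ (t_smul_mem_range_smul hw 2)), hW.t_zero_smul w hw,
    smul_comm (t q 3) θ w, smul_comm (tinv q 1) θ, Submodule.smul_mem_iff _ hθ,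
    hc.tinv_smul_mem_iff (t_smul_mem_range_smul hw 3)] at bracket
  exact bracket

theorem t_three_smul_t_one_smul_mem (hW : IsEigenSubmodule q W θ)
    (hc : HasCentralCharacter q V c) (hq : q ≠ 0) (hθ : θ ≠ 0) (hcθ : c 0 = θ + θ⁻¹)
    (hw : w ∈ W) : t q 3 • t q 1 • w ∈ Set.range (t q) • W := by
  have word : t q 3 • t q 0 • t q 1 • w = q⁻¹ • tinv q 2 • w := by
    rw [tinv_two_eq hq, smul_assoc, inv_smul_smul₀ hq, mul_smul, mul_smul]
  have bracket := t_smul_mem_range_smul (q := q)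
    (hW.t_zero_smul_t_smul_sub_mem hc hcθ hw (i := 1) (by decide)) 3
  rw [smul_sub, word, Submodule.sub_mem_iff_right _
    (Submodule.smul_mem _ _ (hW.tinv_smul_mem_range_smul hc hθ hw 2)), smul_comm,
    Submodule.smul_mem_iff _ (inv_ne_zero hθ)] at bracket
  exact bracket

theorem t_three_smul_t_two_smul_mem (hW : IsEigenSubmodule q W θ)
    (hc : HasCentralCharacter q V c) (hq : q ≠ 0) (hθ : θ ≠ 0) (hcθ : c 0 = θ + θ⁻¹)
    (hw : w ∈ W) : t q 3 • t q 2 • w ∈ Set.range (t q) • W := by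
  have word : tinv q 3 • tinv q 2 • w = q • t q 0 • t q 1 • w := by
    rw [tinv_two_eq hq, smul_assoc, smul_comm, ← mul_smul, ← mul_assoc, tinv_mul_t, one_mul,
      mul_smul]
  have ht (i : Fin 4) := t_smul_mem_range_smul (q := q) hw i
  rw [← hc.tinv_smul_tinv_smul_mem_iff (hW.le_range_smul hθ hw) (ht 3) (ht 2), word]
  exact Submodule.smul_mem _ _ (hW.t_zero_smul_mem hc hθ hcθ (ht 1))

theorem t_smul_mem (hW : IsEigenSubmodule q W θ) (hc : HasCentralCharacter q V c) (hq : q ≠ 0)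
    (hθ : θ ≠ 0) (hcθ : c 0 = θ + θ⁻¹) {i : Fin 4} (hi : i ≠ 2)
    (hx : x ∈ Set.range (t q) • W) : t q i • x ∈ Set.range (t q) • W := by
  suffices Set.range (t q) • W ≤ (Set.range (t q) • W).comap (Algebra.lsmul F F V (t q i)) from
    this hx
  refine Submodule.set_smul_le _ _ _ ?_
  rintro _ w ⟨j, rfl⟩ hw
  change t q i • t q j • w ∈ Set.range (t q) • W
  have left_zero := hW.t_zero_smul_mem hc hθ hcθ (t_smul_mem_range_smul hw j)
  have right_zero := hW.t_smul_t_zero_smul_mem hw i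
  have diagonal := hW.t_smul_t_smul_self_mem hc hθ hw i
  have h₁₂ := hW.t_one_smul_t_two_smul_mem hc hθ hcθ hw
  have h₁₃ := hW.t_one_smul_t_three_smul_mem hc hq hθ hw
  have h₃₁ := hW.t_three_smul_t_one_smul_mem hc hq hθ hcθ hw
  have h₃₂ := hW.t_three_smul_t_two_smul_mem hc hq hθ hcθ hw
  fin_cases i <;> fin_cases j <;> first | assumption | exact absurd rfl hi

theorem eq_tZeroEigenspace [IsSimpleModule (DAHA q) V] (hW : IsEigenSubmodule q W θ)
    (hc : HasCentralCharacter q V c) (hq : q ≠ 0) (hθ : θ ≠ 0) (hθ' : θ ≠ θ⁻¹)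
    (hcθ : c 0 = θ + θ⁻¹) (hne : W ≠ ⊥) : W = tZeroEigenspace q V θ := by
  have range_smul_eq_top : Set.range (t q) • W = ⊤ :=
    hc.eq_top_of_t_smul_mem (fun _ hi _ hx => hW.t_smul_mem hc hq hθ hcθ hi hx) fun hbot =>
      hne (le_bot_iff.1 (hbot ▸ hW.le_range_smul hθ))
  refine le_antisymm (fun w hw => mem_tZeroEigenspace.2 (hW.t_zero_smul w hw)) fun x hx => ?_
  have := hW.t_zero_smul_sub_mem hc hcθ (range_smul_eq_top ▸ Submodule.mem_top : x ∈ _)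
  rwa [mem_tZeroEigenspace.1 hx, ← sub_smul, Submodule.smul_mem_iff _ (sub_ne_zero.2 hθ')] at this

end IsEigenSubmodule

end CentralCharacter

section Even

variable {F : Type*} [Field F] {q : F} {d : ℕ} {k₀ k₁ k₂ k₃ θ : F}
  (h : EParam q d k₀ k₁ k₂ k₃)

theorem EParam.k₀_ne_inv (h : EParam q d k₀ k₁ k₂ k₃) : k₀ ≠ k₀⁻¹ := fun e => by
  have k₀_sq : k₀ ^ 2 = 1 := by rw [pow_two, (mul_eq_one_iff_eq_inv₀ h.k₀_ne).2 e]
  exact h.generic.pow_ne_one _ d.succ_pos (by simpa only [k₀_sq, one_mul] using h.k₀_sq')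

theorem t_smul (i : Fin 4) (w : E h) : t q i • w = tE q d k₀ k₁ k₂ k₃ i w := by
  rw [smul_def_E, repE, t, RingQuot.liftAlgHom_mkAlgHom_apply, FreeAlgebra.lift_ι_apply, genE]

theorem hasCentralCharacter_E :
    HasCentralCharacter q (E h) fun i => ![k₀, k₁, k₂, k₃] i + (![k₀, k₁, k₂, k₃] i)⁻¹ := by
  intro i w
  rw [add_smul, t_smul, smul_def_E, repE, tinv, RingQuot.liftAlgHom_mkAlgHom_apply,
    FreeAlgebra.lift_ι_apply, genE]
  exact add_sub_cancel _ _

instance : IsScalarTower F (AW q) (E h) where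
  smul_assoc a x w := by rw [aw_smul_def, aw_smul_def, map_smul, smul_assoc]

instance : Module.Finite F (E h) := inferInstanceAs (Module.Finite F (Fin (d + 1) → F))

theorem finrank_E : Module.finrank F (E h) = d + 1 :=
  (Module.finrank_fin_fun F : Module.finrank F (Fin (d + 1) → F) = d + 1)

theorem restrictScalars_eigen : (eigen h θ).restrictScalars F = tZeroEigenspace q (E h) θ :=
  Submodule.ext fun _ => mem_tZeroEigenspace.symm

theorem isCompl_eigen : IsCompl (eigen h k₀) (eigen h k₀⁻¹) := by
  rw [← Submodule.isCompl_restrictScalars_iff F, restrictScalars_eigen, restrictScalars_eigen]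
  exact (hasCentralCharacter_E h).isCompl_tZeroEigenspace h.k₀_ne h.k₀_ne_inv rfl

variable {h} in
theorem isEigenSubmodule_of_le_eigen {W : Submodule (AW q) (E h)} (hW : W ≤ eigen h θ) :
    IsEigenSubmodule q (W.restrictScalars F) θ where
  zetaGen_smul_mem g w hw := by
    have := W.smul_mem (RingQuot.mkAlgHom F (AWRel q) (FreeAlgebra.ι F g)) hw
    rwa [aw_smul_def, zeta, RingQuot.liftAlgHom_mkAlgHom_apply, FreeAlgebra.lift_ι_apply] at this
  t_zero_smul _ hw := hW hw

theorem isAtom_eigen [IsSimpleModule (DAHA q) (E h)] (hθ : θ ≠ 0) (hθ' : θ ≠ θ⁻¹)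
    (hk₀ : k₀ + k₀⁻¹ = θ + θ⁻¹) (hne : eigen h θ ≠ ⊥) : IsAtom (eigen h θ) := by
  refine ⟨hne, fun W hW => by_contra fun hW_ne => hW.ne ?_⟩
  rw [← Submodule.restrictScalars_inj F, restrictScalars_eigen]
  exact (isEigenSubmodule_of_le_eigen hW.le).eq_tZeroEigenspace (hasCentralCharacter_E h)
    h.generic.ne_zero hθ hθ' hk₀ (by rwa [Ne, Submodule.restrictScalars_eq_bot_iff])

/-- The basis vector `vᵢ` of `E(k₀,k₁,k₂,k₃)` for `i ≤ d`, and `0` for `i > d`. -/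
def basisVec (i : ℕ) : E h := v F d i

variable {h} in
theorem eq_top_of_forall_basisVec_mem {U : Submodule F (E h)} (hU : ∀ i ≤ d, basisVec h i ∈ U) :
    U = ⊤ := by
  refine top_le_iff.1 ((Pi.basisFun F (Fin (d + 1))).span_eq.ge.trans (Submodule.span_le.2 ?_))
  rintro _ ⟨i, rfl⟩
  have basisFun_eq : Pi.basisFun F (Fin (d + 1)) i = basisVec h i := by
    ext j; simp [basisVec, v, Pi.single_apply, Fin.ext_iff]
  exact basisFun_eq ▸ hU i (by omega)

theorem basisVec_zero_mem_eigen : basisVec h 0 ∈ eigen h k₀ :=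
  (t_smul h 0 _).trans t₀_zero

theorem basisVec_last_mem_eigen : basisVec h d ∈ eigen h k₀ := by
  have t₀v_last : t₀v q d k₀ d = k₀ • v F d d := by
    rw [t₀v, if_neg h.odd.pos.ne', if_pos rfl]
  exact (t_smul h 0 _).trans ((endo_v _ le_rfl).trans t₀v_last)

variable {m : ℕ}

theorem t_zero_smul_basisVec_odd (hm : 2 * m + 1 ≤ d) : t q 0 • basisVec h (2 * m + 1) =
    (k₀⁻¹ * (q ^ (2 * m + 2))⁻¹) • (basisVec h (2 * m + 1) - basisVec h (2 * m + 2)) :=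
  (t_smul h 0 _).trans (t₀_odd h hm)

theorem basisVec_even_mem_eigen_sup {S : Submodule F (E h)} (hm : 2 * m + 1 ≤ d)
    (hS : basisVec h (2 * m + 1) ∈ S) :
    basisVec h (2 * m + 2) ∈ (eigen h k₀).restrictScalars F ⊔ S := by
  have hne : k₀⁻¹ * (q ^ (2 * m + 2))⁻¹ ≠ 0 :=
    mul_ne_zero (inv_ne_zero h.k₀_ne) (inv_ne_zero (pow_ne_zero _ h.generic.ne_zero))
  have hv := Submodule.mem_sup_right (S := (eigen h k₀).restrictScalars F) hS
  have := Submodule.mem_sup_left (T := S) (restrictScalars_eigen h ▸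
    (hasCentralCharacter_E h).t_zero_smul_sub_mem_tZeroEigenspace h.k₀_ne rfl
      (basisVec h (2 * m + 1)))
  rwa [Submodule.sub_mem_iff_left _ (Submodule.smul_mem _ _ hv), t_zero_smul_basisVec_odd h hm,
    Submodule.smul_mem_iff _ hne, Submodule.sub_mem_iff_right _ hv] at this

theorem eigen_sup_span_basisVec_odd : (eigen h k₀).restrictScalars F ⊔
    Submodule.span F (Set.range fun m : Fin (d / 2) => basisVec h (2 * m + 1)) = ⊤ := by
  set S := Submodule.span F (Set.range fun m : Fin (d / 2) => basisVec h (2 * m + 1))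
  have odd_mem {m : ℕ} (hm : 2 * m + 1 < d) : basisVec h (2 * m + 1) ∈ S :=
    Submodule.subset_span ⟨⟨m, by omega⟩, rfl⟩
  refine eq_top_of_forall_basisVec_mem fun i hi => ?_
  rcases eq_or_ne i d with rfl | hid
  · exact Submodule.mem_sup_left (basisVec_last_mem_eigen h)
  obtain ⟨m, rfl | rfl⟩ := i.even_or_odd'
  · rcases m with _ | m
    · exact Submodule.mem_sup_left (basisVec_zero_mem_eigen h)
    · exact basisVec_even_mem_eigen_sup h (by omega) (odd_mem (by omega))
  · exact Submodule.mem_sup_right (odd_mem (by omega))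

theorem lt_two_mul_finrank_eigen : d + 1 < 2 * Module.finrank F (eigen h k₀) := by
  have finrank_sup_le := Submodule.finrank_add_le_finrank_add_finrank
    ((eigen h k₀).restrictScalars F)
    (Submodule.span F (Set.range fun m : Fin (d / 2) => basisVec h (2 * m + 1)))
  have finrank_span_le := finrank_range_le_card (R := F)
    fun m : Fin (d / 2) => basisVec h (2 * m + 1)
  rw [eigen_sup_span_basisVec_odd, finrank_top, finrank_E] at finrank_sup_le
  rw [Set.finrank, Fintype.card_fin] at finrank_span_le
  obtain ⟨m, hm⟩ := h.odd
  change _ < 2 * Module.finrank F ((eigen h k₀).restrictScalars F)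
  omega

theorem eigen_ne_bot : eigen h k₀ ≠ ⊥ := fun hbot => by
  have := lt_two_mul_finrank_eigen h
  rw [hbot, Module.finrank_zero_of_subsingleton] at this
  omega

theorem eigen_eq_top (hd : d = 1) : eigen h k₀ = ⊤ := by
  rw [← Submodule.restrictScalars_eq_top_iff F]
  refine Submodule.eq_top_of_finrank_eq (le_antisymm (Submodule.finrank_le _) ?_)
  have := lt_two_mul_finrank_eigen h
  rw [finrank_E]
  change _ ≤ Module.finrank F (eigen h k₀)
  omega

theorem eigen_inv_ne_bot (hd : 3 ≤ d) : eigen h k₀⁻¹ ≠ ⊥ := fun hbot => by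
  have eigen_top : eigen h k₀ = ⊤ := by simpa [hbot] using (isCompl_eigen h).sup_eq_top
  have t_zero_smul_eq : t q 0 • basisVec h 1 = k₀ • basisVec h 1 :=
    (eigen_top ▸ Submodule.mem_top : basisVec h 1 ∈ eigen h k₀)
  rw [t_zero_smul_basisVec_odd h (m := 0) (by omega)] at t_zero_smul_eq
  have coordinate_two := congrFun (show (k₀⁻¹ * (q ^ 2)⁻¹) • (v F d 1 - v F d 2) = k₀ • v F d 1
    from t_zero_smul_eq) ⟨2, by omega⟩
  simp [v, h.k₀_ne, h.generic.ne_zero] at coordinate_two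

variable {h} in
theorem not_isCompl_eigen_inv_of_isCompl_eigen {X : Submodule (AW q) (E h)}
    (hX : IsCompl X (eigen h k₀)) : ¬IsCompl X (eigen h k₀⁻¹) := fun hX' => by
  have finrank_add : Module.finrank F (eigen h k₀) + Module.finrank F (eigen h k₀⁻¹) = d + 1 :=
    finrank_E h ▸ Submodule.finrank_add_eq_of_isCompl
      ((Submodule.isCompl_restrictScalars_iff F).2 (isCompl_eigen h))
  have finrank_eq : Module.finrank F (eigen h k₀) = Module.finrank F (eigen h k₀⁻¹) :=
    (((X.quotientEquivOfIsCompl _ hX).symm.trans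
      (X.quotientEquivOfIsCompl _ hX')).restrictScalars F).finrank_eq
  have := lt_two_mul_finrank_eigen h
  omega

end Even

end DahaAW

theorem mainTheorem4_general {F : Type*} [Field F] (q : F) (d : ℕ) (k₀ k₁ k₂ k₃ : F)
    (h : EParam q d k₀ k₁ k₂ k₃) (hirr : IsSimpleModule (DAHA q) (E h)) :
    (d = 1 → IsSimpleModule (AW q) (E h)) ∧
    (3 ≤ d → ∃ e : Bool × Bool ≃o Submodule (AW q) (E h),
      e (false, false) = ⊥ ∧ e (true, false) = eigen h k₀ ∧
      e (false, true) = eigen h k₀⁻¹ ∧ e (true, true) = ⊤) := by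
  have atom : IsAtom (eigen h k₀) := isAtom_eigen h h.k₀_ne h.k₀_ne_inv rfl (eigen_ne_bot h)
  refine ⟨fun hd => ?_, fun hd => ?_⟩
  · rw [isSimpleModule_iff, isSimpleOrder_iff_isAtom_top, ← eigen_eq_top h hd]
    exact atom
  · have atom_inv : IsAtom (eigen h k₀⁻¹) :=
      isAtom_eigen h (inv_ne_zero h.k₀_ne) (by rw [inv_inv]; exact h.k₀_ne_inv.symm)
        (by rw [inv_inv, add_comm]) (eigen_inv_ne_bot h hd)
    exact exists_orderIso_bool_prod_of_isCompl (isCompl_eigen h) atom.1 atom_inv.1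
      (eq_bot_or_eq_or_eq_or_eq_top_of_isCompl_of_isAtom (isCompl_eigen h) atom atom_inv
        fun _ => not_isCompl_eigen_inv_of_isCompl_eigen)

/-- The lattice of `△_q`-submodules of an irreducible `ℌ_q`-module `E(k₀,k₁,k₂,k₃)`. The diamond is
expressed by an isomorphism of lattices with `{0,1} × {0,1}`. -/
theorem mainTheorem4 {F : Type*} [Field F] [IsAlgClosed F] (q : F) (d : ℕ) (k₀ k₁ k₂ k₃ : F)
    (h : EParam q d k₀ k₁ k₂ k₃) (hirr : IsSimpleModule (DAHA q) (E h)) :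
    (d = 1 → IsSimpleModule (AW q) (E h)) ∧
    (3 ≤ d → ∃ e : Bool × Bool ≃o Submodule (AW q) (E h),
      e (false, false) = ⊥ ∧ e (true, false) = eigen h k₀ ∧
      e (false, true) = eigen h k₀⁻¹ ∧ e (true, true) = ⊤) :=
  mainTheorem4_general q d k₀ k₁ k₂ k₃ h hirr
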